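/- Let $[n]=\{1,\dots,n\}$. In the Partial Maximization problem of length $m$, Alice holds a sequence $A=\langle a_1,\dots,a_m\rangle$ of numbers in $[m^2]$, and Bob holds the set $P_B=\{(i,a_i) : i\in B\}$ for some $B\subsetneq[m]$; Bob must output $\max\{a_t : t\notin B\}$. In a randomized one-way protocol Alice sends Bob a single message, a bit string depending only on her input and her own random coins, and Bob's output depends only on his input, the message and his own random coins, which are independent of Alice's. The protocol has success probability at least $p$ if, for every instance $(A,P_B)$, Bob's output is correct with probability at least $p$. Its communication is the length in bits of the longest message that Alice sends with positive probability, over all inputs of Alice. **Theorem.** For every constant $\delta$ with $0\le\delta<1$, every randomized one-way protocol for Partial Maximization with success probability at least $1-\delta$ has communication $\Omega(m\log m)$ bits; that is, there are $c>0$ and $m_0$, depending only on $\delta$, such that for every $m\ge m_0$ every such protocol has communication at least $c\,m\log m$. The same holds for protocols for the problem restricted to sequences $A$ whose numbers are pairwise distinct (success is required, and messages are counted, only for such sequences). -/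

import Mathlib

open MeasureTheory
open scoped ENNReal

/-- A randomized one-way (private-coin) communication protocol. Alice holds an input in `X`, Bob an
input in `Y`, and Bob outputs an element of `Z`. Alice and Bob have their own coins, which are
points of two arbitrary probability spaces. Alice sends one message, a bit string that depends only
on her input and her coins; Bob's output depends only on his input, the message and his coins. -/
structure OneWayProtocol (X Y Z : Type) where
  /-- Outcomes of Alice's coins. -/
  AliceCoins : Type
  /-- Outcomes of Bob's coins. -/
  BobCoins : Type
  [measurableSpaceAlice : MeasurableSpace AliceCoins]
  [measurableSpaceBob : MeasurableSpace BobCoins]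
  /-- The distribution of Alice's coins. -/
  aliceLaw : Measure AliceCoins
  /-- The distribution of Bob's coins. -/
  bobLaw : Measure BobCoins
  [isProbAlice : IsProbabilityMeasure aliceLaw]
  [isProbBob : IsProbabilityMeasure bobLaw]
  /-- Alice's message. -/
  message : X → AliceCoins → List Bool
  measurable_message : ∀ x s, MeasurableSet {ω | message x ω = s}
  /-- Bob's output. -/
  output : Y → List Bool → BobCoins → Z
  measurable_output : ∀ y s z, MeasurableSet {ω | output y s ω = z}

namespace OneWayProtocol

variable {X Y Z : Type}

attribute [instance] measurableSpaceAlice measurableSpaceBob isProbAlice isProbBob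

/-- The probability, over the independent coins of Alice and Bob, that Bob outputs `z` when Alice
holds `x` and Bob holds `y`. -/
noncomputable def outputProb (P : OneWayProtocol X Y Z) (x : X) (y : Y) (z : Z) : ℝ :=
  (P.aliceLaw.prod P.bobLaw).real {ω | P.output y (P.message x ω.1) ω.2 = z}

/-- `P` solves, with success probability at least `p`, the problem `R`, where `R x y z` says that
`(x, y)` is a valid pair of inputs and that `z` is the correct answer on it. The success
probability is required on every valid pair of inputs. -/
def SolvesWithProb (P : OneWayProtocol X Y Z) (R : X → Y → Z → Prop) (p : ℝ) : Prop :=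
  ∀ x y z, R x y z → p ≤ P.outputProb x y z

/-- The communication of `P` in bits: the length (possibly `⊤`) of the longest possible message,
over all inputs of Alice and all messages that she sends with positive probability. -/
noncomputable def communication (P : OneWayProtocol X Y Z) : ℕ∞ :=
  ⨆ (x : X) (s : List Bool) (_ : P.aliceLaw {ω | P.message x ω = s} ≠ 0), (s.length : ℕ∞)

end OneWayProtocol

namespace PartialMaximization

/-- Alice's input: a sequence of `m` numbers in `[m²] = {1, …, m²}`. -/
abbrev AliceInput (m : ℕ) : Type := Fin m → Set.Icc (1 : ℕ) (m ^ 2)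

/-- Alice's input when her numbers are promised to be distinct. -/
abbrev DistinctAliceInput (m : ℕ) : Type := {a : AliceInput m // Function.Injective a}

/-- Bob's input: a set of pairs (index, number). -/
abbrev BobInput (m : ℕ) : Type := Finset (Fin m × Set.Icc (1 : ℕ) (m ^ 2))

/-- The set `{(i, aᵢ) | i ∈ B}` of pairs. -/
def revealed {m : ℕ} (a : AliceInput m) (B : Finset (Fin m)) : BobInput m :=
  B.image fun i => (i, a i)

/-- Bob's input is `{(i, aᵢ) | i ∈ B}` for some set `B` of indices, and `z` is the maximum of the
`a_t` with `t ∉ B`. (The maximum exists exactly when `B` is not the set of all indices.) -/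
def IsAnswer {m : ℕ} (a : AliceInput m) (y : BobInput m) (z : ℕ) : Prop :=
  ∃ B : Finset (Fin m), y = revealed a B ∧ IsGreatest {n : ℕ | ∃ t, t ∉ B ∧ (a t : ℕ) = n} z

end PartialMaximization

/-! The problem contains augmented indexing over an alphabet of size `m`. Put `x i` in the `i`-th
block of `m` consecutive numbers: the sequence increases, so if Bob knows the entries after `i`, the
maximum of the rest is entry `i`, which reveals `x i`. Averaging fixes the coins of both players
while keeping the expected number of recovered coordinates, over uniform `x`, at least `(1 - δ) *
m`. For a fixed message, expose `x` from the last coordinate to the first: each time at most one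
value is a hit, which bounds an exponential moment of the number of hits (`sum_prod_hit_le`).
Summing over messages and applying Jensen, `augmentedIndexing_le` shows that many hits need many
messages. -/

/-- If, for each coordinate `i`, the entries of `x` after `i` leave at most one value of `x i` for
which `hit i x` holds, then the number `h x` of hits satisfies `∑ x, t ^ h x ≤ (|α| + t) ^ n`. -/
theorem sum_prod_hit_le {α : Type*} [Fintype α] (t : ℝ) (ht : 1 ≤ t) (n : ℕ)
    (hit : Fin n → (Fin n → α) → Prop)
    (huniq : ∀ i x y, (∀ j, i < j → x j = y j) → hit i x → hit i y → x i = y i) :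
    open Classical in
    ∑ x : Fin n → α, ∏ i, (if hit i x then t else 1) ≤ (Fintype.card α + t) ^ n := by
  classical
  induction n with
  | zero => simp
  | succ n ih =>
    -- A hit at a later coordinate may depend on the head. Quantifying the head away only enlarges
    -- the product, and uniqueness survives because `huniq` compares only entries after `i`.
    obtain ⟨hit', hhit'⟩ : ∃ hit' : Fin n → (Fin n → α) → Prop, ∀ i x,
        hit' i x ↔ ∃ a, hit i.succ (Fin.cons a x : Fin (n + 1) → α) := ⟨_, fun _ _ => Iff.rfl⟩
    have ih' := ih hit' (by
      intro i x y hxy hx hy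
      obtain ⟨a, ha⟩ := (hhit' i x).1 hx
      obtain ⟨b, hb⟩ := (hhit' i y).1 hy
      have := huniq i.succ _ _ (fun j hj => ?_) ha hb
      · simpa using this
      · obtain ⟨k, rfl⟩ := Fin.exists_succ_eq.2 (Fin.ne_zero_of_lt hj)
        simpa using hxy k (Fin.succ_lt_succ_iff.1 hj))
    have first : ∀ x : Fin n → α,
        ∑ a : α, (if hit 0 (Fin.cons a x : Fin (n + 1) → α) then t else 1) ≤
          Fintype.card α + t := by
      intro x
      have hcard : (Finset.univ.filter
          fun a : α => hit 0 (Fin.cons a x : Fin (n + 1) → α)).card ≤ 1 := by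
        refine Finset.card_le_one.2 fun a ha b hb => ?_
        have := huniq 0 _ _ (fun j hj => ?_) (Finset.mem_filter.1 ha).2 (Finset.mem_filter.1 hb).2
        · simpa using this
        · obtain ⟨k, rfl⟩ := Fin.exists_succ_eq.2 (Fin.ne_zero_of_lt hj)
          simp
      calc ∑ a : α, (if hit 0 (Fin.cons a x : Fin (n + 1) → α) then t else 1)
          ≤ ∑ a : α, (1 + if hit 0 (Fin.cons a x : Fin (n + 1) → α) then t else 0) := by
            refine Finset.sum_le_sum fun a _ => ?_
            split_ifs <;> simp
        _ ≤ Fintype.card α + t := by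
            rw [Finset.sum_add_distrib, ← Finset.sum_filter]
            simp only [Finset.sum_const, Finset.card_univ, nsmul_eq_mul, mul_one]
            have : ((Finset.univ.filter
              fun a : α => hit 0 (Fin.cons a x : Fin (n + 1) → α)).card : ℝ) ≤ 1 := by
                exact_mod_cast hcard
            nlinarith
    rw [← (Fin.consEquiv fun _ => α).sum_comp, Fintype.sum_prod_type_right]
    have hpos : ∀ x : Fin n → α, 0 ≤ ∏ i, (if hit' i x then t else 1) := fun x =>
      Finset.prod_nonneg fun i _ => by split_ifs <;> linarith
    calc _ ≤ ∑ x : Fin n → α, ∑ a : α,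
          (if hit 0 (Fin.cons a x : Fin (n + 1) → α) then t else 1) *
            ∏ i, (if hit' i x then t else 1) := by
          refine Finset.sum_le_sum fun x _ => Finset.sum_le_sum fun a _ => ?_
          rw [Fin.prod_univ_succ]
          refine mul_le_mul_of_nonneg_left ?_ (by split_ifs <;> linarith)
          refine Finset.prod_le_prod (fun i _ => by split_ifs <;> linarith) fun i _ => ?_
          by_cases h : hit i.succ (Fin.cons a x : Fin (n + 1) → α)
          · have h' : hit' i x := (hhit' i x).2 ⟨a, h⟩
            simp [Fin.consEquiv, h, h']
          · simp only [Fin.consEquiv, Equiv.coe_fn_mk, h, if_false]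
            split_ifs <;> linarith
      _ ≤ ∑ x : Fin n → α, (Fintype.card α + t) * ∏ i, (if hit' i x then t else 1) := by
          refine Finset.sum_le_sum fun x _ => ?_
          rw [← Finset.sum_mul]
          exact mul_le_mul_of_nonneg_right (first x) (hpos x)
      _ ≤ (Fintype.card α + t) ^ (n + 1) := by
          rw [← Finset.mul_sum, pow_succ']
          exact mul_le_mul_of_nonneg_left ih' (by positivity)

/-- There are fewer than `2 ^ (C + 1)` bit strings of length at most `C`. -/
theorem exists_finset_bitStrings (C : ℕ) :
    ∃ S : Finset (List Bool), (∀ s, s.length ≤ C → s ∈ S) ∧ S.card ≤ 2 ^ (C + 1) := by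
  classical
  refine ⟨(Finset.range (C + 1)).biUnion fun k =>
    Finset.univ.image fun v : List.Vector Bool k => v.1, fun s hs => ?_, ?_⟩
  · simp only [Finset.mem_biUnion, Finset.mem_range, Finset.mem_image, Finset.mem_univ, true_and]
    exact ⟨s.length, by omega, ⟨s, rfl⟩, rfl⟩
  · refine Finset.card_biUnion_le.trans ?_
    calc _ ≤ ∑ k ∈ Finset.range (C + 1), 2 ^ k :=
          Finset.sum_le_sum fun k _ => Finset.card_image_le.trans (by simp)
      _ ≤ 2 ^ (C + 1) := (Nat.geomSum_lt le_rfl (by simp)).le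

/-- Deterministic augmented indexing: if messages come from `S`, and on average over `x` at least
`r` coordinates are recovered from the message and the later coordinates, then `S` is large. -/
theorem augmentedIndexing_le {α M : Type*} [Fintype α] [Nonempty α] (n : ℕ)
    (S : Finset M) (msg : (Fin n → α) → M) (hmsg : ∀ x, msg x ∈ S)
    (hit : M → Fin n → (Fin n → α) → Prop)
    (huniq : ∀ s i x y, (∀ j, i < j → x j = y j) → hit s i x → hit s i y → x i = y i) (r : ℝ)
    (hr : open Classical in r * (Fintype.card α : ℝ) ^ n ≤
      ∑ x : Fin n → α, ∑ i, (if hit (msg x) i x then (1 : ℝ) else 0)) :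
    r * Real.log (Fintype.card α) ≤ Real.log S.card + n * Real.log 2 := by
  classical
  set q : ℝ := (Fintype.card α : ℝ) with hq
  have hq1 : 1 ≤ q := by rw [hq]; exact_mod_cast Fintype.card_pos
  have hq0 : 0 < q := by linarith
  have hqn : 0 < q ^ n := by positivity
  have hcard : (Fintype.card (Fin n → α) : ℝ) = q ^ n := by simp [hq]
  have hS : 0 < (S.card : ℝ) := by
    exact_mod_cast Finset.card_pos.2 ⟨_, hmsg (Classical.arbitrary _)⟩
  -- Weight `q` per hit makes the moment bound `(q + q) ^ n`, so only `n * log 2` is lost.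
  let N : (Fin n → α) → ℝ := fun x =>
    (∑ i, (if hit (msg x) i x then (1 : ℝ) else 0)) * Real.log q
  have hN : ∀ x, Real.exp (N x) = ∏ i, (if hit (msg x) i x then q else 1) := by
    intro x
    simp only [N, Finset.sum_mul]
    rw [Real.exp_sum]
    refine Finset.prod_congr rfl fun i _ => ?_
    split_ifs
    · simp [Real.exp_log hq0]
    · simp
  have upper : ∑ x, Real.exp (N x) ≤ S.card * (2 * q) ^ n := by
    calc ∑ x, Real.exp (N x)
        ≤ ∑ x, ∑ s ∈ S, ∏ i, (if hit s i x then q else 1) := by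
          refine Finset.sum_le_sum fun x _ => ?_
          rw [hN]
          -- Summing over all of `S` decouples the message from `x`.
          exact Finset.single_le_sum (f := fun s => ∏ i, (if hit s i x then q else 1))
            (fun s _ => Finset.prod_nonneg fun i _ => by split_ifs <;> linarith) (hmsg x)
      _ = ∑ s ∈ S, ∑ x, ∏ i, (if hit s i x then q else 1) := Finset.sum_comm
      _ ≤ ∑ s ∈ S, (2 * q) ^ n := by
          refine Finset.sum_le_sum fun s _ => ?_
          rw [two_mul]
          exact sum_prod_hit_le q hq1 n (hit s) (huniq s)
      _ = S.card * (2 * q) ^ n := by simp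
  have jensen := convexOn_exp.map_sum_le (t := Finset.univ)
    (w := fun _ : Fin n → α => (q ^ n)⁻¹) (p := N) (fun _ _ => by positivity)
    (by rw [Finset.sum_const, Finset.card_univ, nsmul_eq_mul, hcard, mul_inv_cancel₀ hqn.ne'])
    (fun _ _ => Set.mem_univ _)
  simp only [smul_eq_mul, ← Finset.mul_sum] at jensen
  have mean : r * Real.log q ≤ (q ^ n)⁻¹ * ∑ x, N x := by
    rw [inv_mul_eq_div, le_div_iff₀ hqn]
    simp only [N, ← Finset.sum_mul]
    nlinarith [mul_le_mul_of_nonneg_right hr (Real.log_nonneg hq1)]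
  have key : Real.exp (r * Real.log q) ≤ S.card * 2 ^ n := by
    calc _ ≤ (q ^ n)⁻¹ * ∑ x, Real.exp (N x) := (Real.exp_le_exp.2 mean).trans jensen
      _ ≤ (q ^ n)⁻¹ * (S.card * (2 * q) ^ n) :=
          mul_le_mul_of_nonneg_left upper (by positivity)
      _ = S.card * 2 ^ n := by rw [mul_pow]; field_simp
  rw [← Real.log_exp (r * Real.log q)]
  refine (Real.log_le_log (Real.exp_pos _) key).trans_eq ?_
  rw [Real.log_mul hS.ne' (by positivity), Real.log_pow]

namespace OneWayProtocol

variable {X Y Z : Type}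

theorem measurableSet_output_message (P : OneWayProtocol X Y Z) (x : X) (y : Y) (z : Z) :
    MeasurableSet {ω : P.AliceCoins × P.BobCoins | P.output y (P.message x ω.1) ω.2 = z} := by
  -- There are only countably many messages, and for each one the event is a rectangle.
  have : {ω : P.AliceCoins × P.BobCoins | P.output y (P.message x ω.1) ω.2 = z} =
      ⋃ s : List Bool, {ω | P.message x ω = s} ×ˢ {ω | P.output y s ω = z} := by
    ext ω
    simp
  rw [this]
  exact MeasurableSet.iUnion fun s =>
    (P.measurable_message x s).prod (P.measurable_output y s z)

/-- Almost surely, messages are no longer than the communication. -/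
theorem ae_length_message_le (P : OneWayProtocol X Y Z) (x : X) :
    ∀ᵐ ω ∂P.aliceLaw, ((P.message x ω).length : ℕ∞) ≤ P.communication := by
  have h : ∀ᵐ ω ∂P.aliceLaw, ∀ s : List Bool,
      P.aliceLaw {ω | P.message x ω = s} = 0 → P.message x ω ≠ s := by
    refine ae_all_iff.2 fun s => ?_
    by_cases hs : P.aliceLaw {ω | P.message x ω = s} = 0
    · simp [ae_iff, hs]
    · simp [hs]
  filter_upwards [h] with ω hω
  have h0 : P.aliceLaw {ω' | P.message x ω' = P.message x ω} ≠ 0 := fun h0 => hω _ h0 rfl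
  exact le_iSup_of_le x (le_iSup_of_le (P.message x ω) (le_iSup_of_le h0 le_rfl))

/-- A protocol that solves augmented indexing (for each `i`, Bob recovers `x i` from the message
and the later entries of `x`) with probability at least `p` has large communication. -/
theorem le_communication_of_augmentedIndexing {α : Type} [Fintype α] [Nonempty α] {n : ℕ}
    (P : OneWayProtocol X Y Z) (enc : (Fin n → α) → X) (query : Fin n → (Fin n → α) → Y)
    (answer : Fin n → α → Z) (hanswer : ∀ i, Function.Injective (answer i))
    (hquery : ∀ i x y, (∀ j, i < j → x j = y j) → query i x = query i y) (p : ℝ)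
    (hp : ∀ x i, p ≤ P.outputProb (enc x) (query i x) (answer i (x i)))
    (C : ℕ) (hC : P.communication = C) :
    p * n * Real.log (Fintype.card α) ≤ (C + 1) * Real.log 2 + n * Real.log 2 := by
  classical
  obtain ⟨S, hS, hScard⟩ := exists_finset_bitStrings C
  let E : (Fin n → α) → Fin n → Set (P.AliceCoins × P.BobCoins) := fun x i =>
    {ω | P.output (query i x) (P.message (enc x) ω.1) ω.2 = answer i (x i)}
  have hE : ∀ x i, MeasurableSet (E x i) := fun x i => P.measurableSet_output_message _ _ _
  let F : P.AliceCoins × P.BobCoins → ℝ := fun ω => ∑ x, ∑ i, (E x i).indicator 1 ω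
  have hint : ∀ x i, Integrable ((E x i).indicator (1 : P.AliceCoins × P.BobCoins → ℝ))
      (P.aliceLaw.prod P.bobLaw) := fun x i => (integrable_const (1 : ℝ)).indicator (hE x i)
  have hFint : Integrable F (P.aliceLaw.prod P.bobLaw) :=
    integrable_finsetSum _ fun x _ => integrable_finsetSum _ fun i _ => hint x i
  have hmean : p * n * (Fintype.card α : ℝ) ^ n ≤ ∫ ω, F ω ∂(P.aliceLaw.prod P.bobLaw) := by
    have : ∫ ω, F ω ∂(P.aliceLaw.prod P.bobLaw) =
        ∑ x, ∑ i, P.outputProb (enc x) (query i x) (answer i (x i)) := by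
      simp only [F]
      rw [integral_finsetSum _ fun x _ => integrable_finsetSum _ fun i _ => hint x i]
      refine Finset.sum_congr rfl fun x _ => ?_
      rw [integral_finsetSum _ fun i _ => hint x i]
      exact Finset.sum_congr rfl fun i _ => integral_indicator_one (hE x i)
    rw [this]
    calc p * n * (Fintype.card α : ℝ) ^ n = ∑ x : Fin n → α, ∑ i : Fin n, p := by
          simp; ring
      _ ≤ _ := Finset.sum_le_sum fun x _ => Finset.sum_le_sum fun i _ => hp x i
  have hshort : ∀ᵐ ω ∂(P.aliceLaw.prod P.bobLaw), ∀ x, P.message (enc x) ω.1 ∈ S := by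
    refine ae_all_iff.2 fun x => ?_
    filter_upwards [Measure.quasiMeasurePreserving_fst.ae (P.ae_length_message_le (enc x))] with ω h
    rw [hC] at h
    exact hS _ (by exact_mod_cast h)
  -- Some outcome of the coins is at least average and avoids the null set of overlong messages.
  obtain ⟨ω, hω, hFω⟩ := exists_notMem_null_integral_le hFint (ae_iff.1 hshort)
  simp only [Set.mem_ofPred_eq, not_not] at hω
  have key := augmentedIndexing_le n S (fun x => P.message (enc x) ω.1) hω
    (fun s i x => P.output (query i x) s ω.2 = answer i (x i))
    (fun s i x y hxy hx hy => hanswer i (by rw [← hx, ← hy, hquery i x y hxy])) (p * n)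
    ((hmean.trans hFω).trans_eq (Finset.sum_congr rfl fun x _ => Finset.sum_congr rfl fun i _ => by
      simp [E, Set.indicator_apply]))
  have hSpos : 0 < (S.card : ℝ) := by
    exact_mod_cast Finset.card_pos.2 ⟨_, hω (Classical.arbitrary _)⟩
  have hlog : Real.log S.card ≤ (C + 1) * Real.log 2 := by
    have := Real.log_le_log hSpos (show (S.card : ℝ) ≤ 2 ^ (C + 1) by exact_mod_cast hScard)
    rw [Real.log_pow] at this
    exact_mod_cast this
  linarith

end OneWayProtocol

namespace PartialMaximization

/-- The increasing sequence whose `i`-th number is the `x i`-th element of the `i`-th block of `m`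
consecutive numbers. -/
def blockInput {m : ℕ} (x : Fin m → Fin m) : AliceInput m := fun i =>
  ⟨i * m + x i + 1, by
    have hi : (i : ℕ) + 1 ≤ m := i.2
    have hx : (x i : ℕ) + 1 ≤ m := (x i).2
    exact ⟨by omega, by nlinarith⟩⟩

theorem blockInput_strictMono {m : ℕ} (x : Fin m → Fin m) : StrictMono (blockInput x) := by
  intro i j hij
  have hx : (x i : ℕ) + 1 ≤ m := (x i).2
  have hij : (i : ℕ) + 1 ≤ j := hij
  change (i : ℕ) * m + x i + 1 < j * m + x j + 1
  nlinarith

theorem isAnswer_blockInput {m : ℕ} (x : Fin m → Fin m) (i : Fin m) :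
    IsAnswer (blockInput x) (revealed (blockInput x) (Finset.Ioi i)) (i * m + x i + 1) := by
  refine ⟨_, rfl, ⟨i, by simp, rfl⟩, ?_⟩
  rintro _ ⟨t, ht, rfl⟩
  exact (blockInput_strictMono x).monotone (not_lt.1 fun h => ht (Finset.mem_Ioi.2 h))

theorem revealed_blockInput_congr {m : ℕ} (i : Fin m) (x y : Fin m → Fin m)
    (h : ∀ j, i < j → x j = y j) :
    revealed (blockInput x) (Finset.Ioi i) = revealed (blockInput y) (Finset.Ioi i) := by
  refine Finset.image_congr fun j hj => ?_
  have hj : i < j := by simpa using hj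
  simp [blockInput, h j hj]

/-- A protocol that answers correctly, with probability at least `1 - δ`, on the increasing
sequences `blockInput x` has communication at least `(1 - δ) / 2 * m * log m` for large `m`. -/
theorem le_communication_of_blockInput {X : Type} {m : ℕ} {δ : ℝ}
    (hm : 1 ≤ m) (hlog : 4 ≤ (1 - δ) * Real.log m) (P : OneWayProtocol X (BobInput m) ℕ)
    (enc : (Fin m → Fin m) → X)
    (hP : ∀ x i, 1 - δ ≤ P.outputProb (enc x)
      (revealed (blockInput x) (Finset.Ioi i)) (i * m + x i + 1)) :
    ENNReal.ofReal ((1 - δ) / 2 * (m * Real.log m)) ≤ (P.communication : ℝ≥0∞) := by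
  cases hC : P.communication with
  | top => simp
  | coe C =>
    have : Nonempty (Fin m) := ⟨⟨0, hm⟩⟩
    have key := P.le_communication_of_augmentedIndexing enc
      (fun i x => revealed (blockInput x) (Finset.Ioi i)) (fun i v => i * m + v + 1)
      (fun i v w h => Fin.ext (by simpa using h)) revealed_blockInput_congr (1 - δ) hP C hC
    rw [Fintype.card_fin] at key
    have hm' : (1 : ℝ) ≤ m := by exact_mod_cast hm
    have hC0 : (0 : ℝ) ≤ C := C.cast_nonneg
    have hlog2 : Real.log 2 ≤ 1 := by linarith [Real.log_two_lt_d9]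
    have h2 : ((C : ℝ) + 1 + m) * Real.log 2 ≤ C + 1 + m :=
      mul_le_of_le_one_right (by positivity) hlog2
    -- The threshold `4` makes the loss `1 + m ≤ 2 * m` at most half of `(1 - δ) * m * log m`.
    have h4 : (m : ℝ) * 4 ≤ m * ((1 - δ) * Real.log m) :=
      mul_le_mul_of_nonneg_left hlog (by positivity)
    have : (1 - δ) / 2 * (m * Real.log m) ≤ C := by nlinarith
    refine (ENNReal.ofReal_le_ofReal this).trans ?_
    simp

end PartialMaximization

theorem theoremA5 (δ : ℝ) (hδ0 : 0 ≤ δ) (hδ1 : δ < 1) :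
    ∃ c : ℝ, 0 < c ∧ ∃ m₀ : ℕ, ∀ m : ℕ, m₀ ≤ m →
      (∀ P : OneWayProtocol (PartialMaximization.AliceInput m)
          (PartialMaximization.BobInput m) ℕ,
        P.SolvesWithProb PartialMaximization.IsAnswer (1 - δ) →
          ENNReal.ofReal (c * (m * Real.log m)) ≤ (P.communication : ℝ≥0∞)) ∧
      (∀ P : OneWayProtocol (PartialMaximization.DistinctAliceInput m)
          (PartialMaximization.BobInput m) ℕ,
        P.SolvesWithProb (fun a => PartialMaximization.IsAnswer a.1) (1 - δ) →
          ENNReal.ofReal (c * (m * Real.log m)) ≤ (P.communication : ℝ≥0∞)) := by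
  have hδ : 0 < 1 - δ := by linarith
  have htend : Filter.Tendsto (fun m : ℕ => (1 - δ) * Real.log m) Filter.atTop Filter.atTop :=
    (Real.tendsto_log_atTop.comp tendsto_natCast_atTop_atTop).const_mul_atTop hδ
  obtain ⟨m₀, hm₀⟩ := Filter.eventually_atTop.1
    ((htend.eventually_ge_atTop 4).and (Filter.eventually_ge_atTop 1))
  refine ⟨(1 - δ) / 2, by positivity, m₀, fun m hm => ⟨fun P hP => ?_, fun P hP => ?_⟩⟩
  · exact PartialMaximization.le_communication_of_blockInput (hm₀ m hm).2 (hm₀ m hm).1 P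
      PartialMaximization.blockInput
      fun x i => hP _ _ _ (PartialMaximization.isAnswer_blockInput x i)
  · exact PartialMaximization.le_communication_of_blockInput (hm₀ m hm).2 (hm₀ m hm).1 P
      (fun x => ⟨PartialMaximization.blockInput x,
        (PartialMaximization.blockInput_strictMono x).injective⟩)
      fun x i => hP _ _ _ (PartialMaximization.isAnswer_blockInput x i)
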